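/- Let $d\in\mathbb N$, $H\in(1,\infty)\setminus\mathbb Z$, $x_0\in\mathbb R^d$, and let $W$ be a two-sided standard $d$-dimensional Brownian motion on a probability space $(\Omega,\mathcal F,\mathbb P)$. For $h:=H-\lfloor H\rfloor\in(0,1)$ let $B^h$ be the continuous version of $$B^h_t=\int_{-\infty}^0\big(|t-s|^{h-\frac12}-|s|^{h-\frac12}\big)\,dW_s+\int_0^t|t-s|^{h-\frac12}\,dW_s,\qquad t\ge 0,$$ and let $$B^H_t=\int_{0\le s_1\le\dots\le s_{\lfloor H\rfloor}\le t}B^h_{s_1}\,ds_1\cdots ds_{\lfloor H\rfloor},\qquad t\ge0,$$ be the fractional Brownian motion with Hurst index $H$. Write $\mathcal C^1$ for the class of bounded, continuously differentiable $b:\mathbb R^d\to\mathbb R^d$ whose gradient $\nabla b$ is bounded. For $b\in\mathcal C^1$ let $X$ be the (pathwise unique) continuous solution and $X^n$, $n\ge1$, the Euler–Maruyama approximation, on $[0,1]$: $$X_t=x_0+\int_0^t b(X_s)\,ds+B^H_t,\qquad X^n_t=x_0+\int_0^t b\big(X^n_{\lfloor ns\rfloor/n}\big)\,ds+B^H_t.$$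 (i) For every $b\in\mathcal C^1$, almost surely the path $t\mapsto B^H_t$ is differentiable on $[0,1]$, the limit $c(t):=\lim_{n\to\infty}n(X_t-X^n_t)$ exists for every $t\in[0,1]$, and the function $c$ is differentiable on $[0,1]$ and satisfies $$c'(t)=\nabla b(X_t)\,c(t)+\tfrac12\nabla b(X_t)\big(b(X_t)+(B^H_t)'\big)\quad\text{for all }t\in[0,1],\qquad c(0)=0$$ (derivatives at the endpoints $0$ and $1$ are one-sided). (ii) The rate $n^{-1}$ cannot be improved in general: if $d\ge1$, there is $b\in\mathcal C^1$ for which, almost surely, $\lim_{n\to\infty}n(X_t-X^n_t)$ exists and is nonzero for some $t\in[0,1]$. -/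

import Mathlib

open MeasureTheory ProbabilityTheory Filter Topology Set
open scoped ENNReal

namespace EulerFBM

noncomputable section

/-- `W` is a two-sided standard `d`-dimensional Brownian motion, indexed by the whole real line. -/
structure IsTwoSidedBrownian {d : ℕ} {Ω : Type*} [MeasurableSpace Ω]
    (W : ℝ → Ω → EuclideanSpace ℝ (Fin d)) (P : Measure Ω) : Prop where
  zero : ∀ᵐ ω ∂P, W 0 ω = 0
  indep : HasIndepIncrements W P
  law : ∀ s t : ℝ, s ≤ t →
    HasLaw (fun ω => W t ω - W s ω)
      (multivariateGaussian 0 ((t - s) • (1 : Matrix (Fin d) (Fin d) ℝ))) P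
  cont : ∀ᵐ ω ∂P, Continuous fun t => W t ω

/-- The step function equal to `a i` on `(s i, s (i + 1)]` and to zero elsewhere. -/
def stepFun {m : ℕ} (s : Fin (m + 1) → ℝ) (a : Fin m → ℝ) (r : ℝ) : ℝ :=
  ∑ i : Fin m, (Ioc (s i.castSucc) (s i.succ)).indicator (fun _ => a i) r

/-- The integral `∑ i, a i (W (s (i + 1)) - W (s i))` of a step function. -/
def stepIntegral {d : ℕ} {Ω : Type*} (W : ℝ → Ω → EuclideanSpace ℝ (Fin d))
    {m : ℕ} (s : Fin (m + 1) → ℝ) (a : Fin m → ℝ) (ω : Ω) : EuclideanSpace ℝ (Fin d) :=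
  ∑ i : Fin m, a i • (W (s i.succ) ω - W (s i.castSucc) ω)

/-- `I` is (a version of) the Wiener integral `∫ f(r) dW_r` over the whole line: the limit in
`L²(P)` of the integrals of step functions that converge to `f` in `L²(ℝ)`. -/
def IsWienerIntegral {d : ℕ} {Ω : Type*} [MeasurableSpace Ω]
    (W : ℝ → Ω → EuclideanSpace ℝ (Fin d)) (P : Measure Ω)
    (f : ℝ → ℝ) (I : Ω → EuclideanSpace ℝ (Fin d)) : Prop :=
  MemLp I 2 P ∧
    ∀ ε : ℝ≥0∞, 0 < ε → ∃ (m : ℕ) (s : Fin (m + 1) → ℝ) (a : Fin m → ℝ), Monotone s ∧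
      eLpNorm (fun r => f r - stepFun s a r) 2 volume ≤ ε ∧
      eLpNorm (fun ω => I ω - stepIntegral W s a ω) 2 P ≤ ε

/-- The Mandelbrot - van Ness kernel with Hurst index `h ∈ (0, 1)`, at time `t ≥ 0`. -/
def mvnKernel (h t r : ℝ) : ℝ :=
  if r < 0 then |t - r| ^ (h - 1 / 2) - |r| ^ (h - 1 / 2)
  else if r < t then |t - r| ^ (h - 1 / 2)
  else 0

/-- `β` is the (continuous version of the) fractional Brownian motion with Hurst index
`h ∈ (0, 1)` driven by `W`, given by the Mandelbrot - van Ness representation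
`β_t = ∫_{-∞}^0 (|t-r|^{h-1/2} - |r|^{h-1/2}) dW_r + ∫_0^t |t-r|^{h-1/2} dW_r`. -/
structure IsRoughFBM {d : ℕ} {Ω : Type*} [MeasurableSpace Ω] (h : ℝ)
    (W : ℝ → Ω → EuclideanSpace ℝ (Fin d)) (P : Measure Ω)
    (β : ℝ → Ω → EuclideanSpace ℝ (Fin d)) : Prop where
  integral : ∀ t : ℝ, 0 ≤ t → IsWienerIntegral W P (mvnKernel h t) (β t)
  cont : ∀ᵐ ω ∂P, ContinuousOn (fun t => β t ω) (Ici 0)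

/-- The `k`-fold iterated integral
`t ↦ ∫_{0 ≤ s_1 ≤ ... ≤ s_k ≤ t} f(s_1) ds_1 ... ds_k` (equal to `f` itself for `k = 0`). -/
def iterIntegral {E : Type*} [NormedAddCommGroup E] [NormedSpace ℝ E]
    (f : ℝ → E) : ℕ → ℝ → E
  | 0 => f
  | k + 1 => fun t => ∫ s in (0 : ℝ)..t, iterIntegral f k s

/-- `B` is the fractional Brownian motion with Hurst index `H ∈ (0, ∞) \ ℤ` driven by `W`: the
`⌊H⌋`-fold iterated integral of the fractional Brownian motion with Hurst index `H - ⌊H⌋`. -/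
def IsFBM {d : ℕ} {Ω : Type*} [MeasurableSpace Ω] (H : ℝ)
    (W : ℝ → Ω → EuclideanSpace ℝ (Fin d)) (P : Measure Ω)
    (B : ℝ → Ω → EuclideanSpace ℝ (Fin d)) : Prop :=
  ∃ β : ℝ → Ω → EuclideanSpace ℝ (Fin d), IsRoughFBM (Int.fract H) W P β ∧
    ∀ᵐ ω ∂P, ∀ t : ℝ, 0 ≤ t → B t ω = iterIntegral (fun s => β s ω) ⌊H⌋₊ t

/-- The class `𝒞¹`: bounded continuously differentiable vector fields with bounded gradient. -/
structure IsC1 {d : ℕ} (b : EuclideanSpace ℝ (Fin d) → EuclideanSpace ℝ (Fin d)) : Prop where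
  contDiff : ContDiff ℝ 1 b
  bounded : ∃ M : ℝ, ∀ x, ‖b x‖ ≤ M
  bounded_fderiv : ∃ M : ℝ, ∀ x, ‖fderiv ℝ b x‖ ≤ M

/-- `X` solves `dX_t = b(X_t) dt + dB_t`, `X_0 = x₀`, on `[0, 1]`. -/
def IsSolution {d : ℕ} {Ω : Type*} [MeasurableSpace Ω]
    (b : EuclideanSpace ℝ (Fin d) → EuclideanSpace ℝ (Fin d))
    (B : ℝ → Ω → EuclideanSpace ℝ (Fin d)) (P : Measure Ω)
    (x₀ : EuclideanSpace ℝ (Fin d)) (X : ℝ → Ω → EuclideanSpace ℝ (Fin d)) : Prop :=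
  ∀ᵐ ω ∂P, ContinuousOn (fun t => X t ω) (Icc 0 1) ∧
    ∀ t ∈ Icc (0 : ℝ) 1, X t ω = x₀ + (∫ s in (0 : ℝ)..t, b (X s ω)) + B t ω

/-- The grid point `k_n(t) = ⌊n t⌋ / n`, for `t ≥ 0`. -/
def gridPoint (n : ℕ) (t : ℝ) : ℝ := (⌊(n : ℝ) * t⌋₊ : ℝ) / n

/-- `Y` is the Euler - Maruyama approximation with step `1 / n`: it solves
`dY_t = b(Y_{k_n(t)}) dt + dB_t`, `Y_0 = x₀`, on `[0, 1]`. -/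
def IsEuler {d : ℕ} {Ω : Type*} [MeasurableSpace Ω] (n : ℕ)
    (b : EuclideanSpace ℝ (Fin d) → EuclideanSpace ℝ (Fin d))
    (B : ℝ → Ω → EuclideanSpace ℝ (Fin d)) (P : Measure Ω)
    (x₀ : EuclideanSpace ℝ (Fin d)) (Y : ℝ → Ω → EuclideanSpace ℝ (Fin d)) : Prop :=
  ∀ᵐ ω ∂P, ∀ t ∈ Icc (0 : ℝ) 1,
    Y t ω = x₀ + (∫ s in (0 : ℝ)..t, b (Y (gridPoint n s) ω)) + B t ω

end

end EulerFBM

/-!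
The statement is pathwise. As `⌊H⌋ ≥ 1`, almost every path of `B` is `C¹` on `[0, 1]`, with some
derivative `B'`, and so is the solution `X`, with velocity `V = b(X) + B'`. Write `D = X - Y n` for
the error of the Euler scheme and `k` for the last grid point before `s`.

Grönwall's inequality gives `X s - Y n k = O(1 / n)` (`norm_sub_comp_gridPoint_le`), so that `D`
changes by `O(1 / n²)` over a cell of the grid. Expanding `b` to first order at `X s` and
`X s - X k` to first order in time,
`n (b (X s) - b (Y n k)) = ∇b(X s) (n D s) + n (s - k) ∇b(X s) (V s) + o(1)`.
The sawtooth `n (s - k)` has mean `1 / 2` on every cell, hence may be replaced by `1 / 2` under the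
integral (`eventually_norm_integral_sawtooth_le`). So `n D` solves, up to a uniformly vanishing
defect, the linear integral equation `c = ∫ (∇b(X) c + (1 / 2) ∇b(X) V)`
(`eventually_norm_error_defect_le`). Approximate solutions of such an equation form a uniform
Cauchy sequence, again by Grönwall's inequality, and their limit is an exact solution
(`exists_tendsto_of_approx_volterra`); the existence of `c` comes out of this and need not be known
beforehand.

For the optimality of the rate, `c 0 = 0` and the linear equation give
`c' 0 = (1 / 2) ∇b(x₀) (b(x₀) + B' 0)`. Take `∇b(x₀) = id` and `b(x₀) = -v`
(`exists_isC1_fderiv_eq_id`), where `v` is not an atom of the law of `B' 0`; such a `v` exists since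
a law has at most countably many atoms (`exists_ae_ne`). Then almost surely `c' 0 ≠ 0`, so `c` does
not vanish identically.
-/

namespace EulerFBM

section Pathwise

/-! ### Integrals over `[0, 1]`, Grönwall's inequality and the time grid -/

variable {E : Type*} [NormedAddCommGroup E]

lemma intervalIntegrable_of_continuousOn {g : ℝ → E} (hg : ContinuousOn g (Icc 0 1)) {s t : ℝ}
    (hs : s ∈ Icc (0 : ℝ) 1) (ht : t ∈ Icc (0 : ℝ) 1) : IntervalIntegrable g volume s t :=
  (hg.mono (uIcc_subset_Icc hs ht)).intervalIntegrable

lemma eventually_forall_norm_sub_le {g : ℝ → E} (hg : ContinuousOn g (Icc 0 1)) {ε : ℝ}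
    (hε : 0 < ε) : ∀ᶠ n : ℕ in atTop, ∀ s ∈ Icc (0 : ℝ) 1, ∀ r ∈ Icc (0 : ℝ) 1,
      |s - r| ≤ 1 / n → ‖g s - g r‖ ≤ ε := by
  obtain ⟨δ, hδ, h⟩ := Metric.uniformContinuousOn_iff.1
    (isCompact_Icc.uniformContinuousOn_of_continuous hg) ε hε
  filter_upwards [(tendsto_const_div_atTop_nhds_zero_nat (1 : ℝ)).eventually_lt_const hδ]
    with n hn s hs r hr hsr
  rw [← dist_eq_norm]
  exact (h s hs r hr (hsr.trans_lt hn)).le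

lemma intervalIntegrable_comp_floor (F : ℕ → E) (n : ℕ) (s t : ℝ) :
    IntervalIntegrable (fun r : ℝ => F ⌊(n : ℝ) * r⌋₊) volume s t := by
  have hm : StronglyMeasurable (fun r : ℝ => F ⌊(n : ℝ) * r⌋₊) :=
    (StronglyMeasurable.of_discrete (f := F)).comp_measurable
      (Nat.measurable_floor.comp (measurable_const_mul _))
  set N := ⌊(n : ℝ) * max s t⌋₊
  refine (intervalIntegrable_const (c := ∑ k ∈ Finset.range (N + 1), ‖F k‖)).mono_fun'
    hm.aestronglyMeasurable ?_
  refine (ae_restrict_iff' measurableSet_uIoc).2 (Eventually.of_forall fun r hr => ?_)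
  refine Finset.single_le_sum (f := fun k => ‖F k‖) (fun k _ => norm_nonneg _)
    (Finset.mem_range.2 (Nat.lt_succ_of_le (Nat.floor_mono ?_)))
  exact mul_le_mul_of_nonneg_left hr.2 (Nat.cast_nonneg n)

lemma intervalIntegrable_comp_gridPoint (F : ℝ → E) (n : ℕ) (s t : ℝ) :
    IntervalIntegrable (fun r : ℝ => F (gridPoint n r)) volume s t :=
  intervalIntegrable_comp_floor (fun k => F ((k : ℝ) / n)) n s t

lemma intervalIntegrable_drift_sub {b : E → E} (hb : Continuous b) {X : ℝ → E}
    (hX : ContinuousOn X (Icc 0 1)) (Y : ℝ → E) (n : ℕ) {s t : ℝ}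
    (hs : s ∈ Icc (0 : ℝ) 1) (ht : t ∈ Icc (0 : ℝ) 1) :
    IntervalIntegrable (fun r => b (X r) - b (Y (gridPoint n r))) volume s t :=
  (intervalIntegrable_of_continuousOn (hb.comp_continuousOn hX) hs ht).sub
    (intervalIntegrable_comp_gridPoint (fun r => b (Y r)) n s t)

variable [NormedSpace ℝ E]

lemma hasDerivWithinAt_integral [CompleteSpace E] {g : ℝ → E} (hg : ContinuousOn g (Icc 0 1))
    {t : ℝ} (ht : t ∈ Icc (0 : ℝ) 1) :
    HasDerivWithinAt (fun u => ∫ s in (0 : ℝ)..u, g s) (g t) (Icc 0 1) t := by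
  have : Fact (t ∈ Icc (0 : ℝ) 1) := ⟨ht⟩
  exact intervalIntegral.integral_hasDerivWithinAt_right
    (intervalIntegrable_of_continuousOn hg (by simp) ht)
    (hg.stronglyMeasurableAtFilter_nhdsWithin measurableSet_Icc t) (hg t ht)

/-- Grönwall's inequality in integral form on `[0, 1]`. -/
lemma le_mul_exp_of_le_add_integral {u : ℝ → ℝ} {a K : ℝ} (hu : ContinuousOn u (Icc 0 1))
    (hu0 : ∀ t ∈ Icc (0 : ℝ) 1, 0 ≤ u t) (ha : 0 ≤ a) (hK : 0 ≤ K)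
    (h : ∀ t ∈ Icc (0 : ℝ) 1, u t ≤ a + K * ∫ s in (0 : ℝ)..t, u s) :
    ∀ t ∈ Icc (0 : ℝ) 1, u t ≤ a * Real.exp K := by
  have hd : ∀ t ∈ Icc (0 : ℝ) 1,
      HasDerivWithinAt (fun t => a + K * ∫ s in (0 : ℝ)..t, u s) (K * u t) (Icc 0 1) t :=
    fun t ht => ((hasDerivWithinAt_integral hu ht).const_mul K).const_add a
  intro t ht
  have := norm_le_gronwallBound_of_norm_deriv_right_le (δ := a) (K := K) (ε := 0)
    (fun t ht => (hd t ht).continuousWithinAt)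
    (fun t ht => (hd t (Ico_subset_Icc_self ht)).mono_of_mem_nhdsWithin
      (Icc_mem_nhdsGE_of_mem ht))
    (by simp [abs_of_nonneg ha]) (fun t ht => by
      have ht := Ico_subset_Icc_self ht
      rw [add_zero, Real.norm_of_nonneg (mul_nonneg hK (hu0 t ht))]
      exact mul_le_mul_of_nonneg_left ((h t ht).trans (le_abs_self _)) hK) t ht
  rw [gronwallBound_ε0, sub_zero] at this
  refine (h t ht).trans ((le_abs_self _).trans (this.trans ?_))
  gcongr
  nlinarith [ht.2]

/-! ### Averaging over the cells of the time grid -/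

lemma gridPoint_nonneg (n : ℕ) (s : ℝ) : 0 ≤ gridPoint n s := by
  unfold gridPoint; positivity

lemma gridPoint_le {n : ℕ} (hn : 1 ≤ n) {s : ℝ} (hs : 0 ≤ s) : gridPoint n s ≤ s := by
  have hn' : (0 : ℝ) < n := by exact_mod_cast hn
  rw [gridPoint, div_le_iff₀ hn', mul_comm s]
  exact Nat.floor_le (by positivity)

lemma gridPoint_mem {n : ℕ} (hn : 1 ≤ n) {s : ℝ} (hs : s ∈ Icc (0 : ℝ) 1) :
    gridPoint n s ∈ Icc (0 : ℝ) 1 :=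
  ⟨gridPoint_nonneg n s, (gridPoint_le hn hs.1).trans hs.2⟩

lemma mul_sub_gridPoint_lt {n : ℕ} (hn : 1 ≤ n) (s : ℝ) :
    n * (s - gridPoint n s) < 1 := by
  have hn' : (0 : ℝ) < n := by exact_mod_cast hn
  rw [gridPoint, mul_sub, mul_div_cancel₀ _ hn'.ne']
  linarith [Nat.lt_floor_add_one ((n : ℝ) * s)]

lemma abs_sub_gridPoint_le {n : ℕ} (hn : 1 ≤ n) {s : ℝ} (hs : 0 ≤ s) :
    |s - gridPoint n s| ≤ 1 / n := by
  have hn' : (0 : ℝ) < n := by exact_mod_cast hn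
  rw [abs_of_nonneg (sub_nonneg.2 (gridPoint_le hn hs)), le_div_iff₀ hn', mul_comm]
  exact (mul_sub_gridPoint_lt hn s).le

lemma intervalIntegrable_sawtooth_smul {g : ℝ → E} (hg : ContinuousOn g (Icc 0 1)) (n : ℕ)
    (a : ℝ) {s t : ℝ} (hs : s ∈ Icc (0 : ℝ) 1) (ht : t ∈ Icc (0 : ℝ) 1) :
    IntervalIntegrable (fun r => (n * (r - gridPoint n r) - a) • g r) volume s t := by
  refine IntervalIntegrable.smul_continuousOn ?_ (hg.mono (uIcc_subset_Icc hs ht))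
  refine (((continuous_id.intervalIntegrable _ _).sub ?_).const_mul _).sub
    intervalIntegrable_const
  exact intervalIntegrable_comp_gridPoint (fun x => x) n s t

/-- On one cell of the grid the centred sawtooth integrates to zero, so only the oscillation of `g`
matters. -/
lemma norm_integral_sawtooth_cell_le [CompleteSpace E] {g : ℝ → E}
    (hg : ContinuousOn g (Icc 0 1)) {n j : ℕ} (hj : j < n) {ε : ℝ}
    (hε : ∀ s ∈ Icc (0 : ℝ) 1, ∀ r ∈ Icc (0 : ℝ) 1, |s - r| ≤ 1 / n → ‖g s - g r‖ ≤ ε) :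
    ‖∫ r in (j / n : ℝ)..((j + 1 : ℕ) / n : ℝ), (n * (r - gridPoint n r) - 1 / 2) • g r‖
      ≤ ε / n := by
  have hn : (0 : ℝ) < n := by exact_mod_cast (Nat.zero_le j).trans_lt hj
  have hj' : (j : ℝ) + 1 ≤ n := by exact_mod_cast hj
  have hle : (j / n : ℝ) ≤ (j + 1 : ℕ) / n := by push_cast; gcongr; linarith
  have hl : (j / n : ℝ) ∈ Icc (0 : ℝ) 1 := ⟨by positivity, by rw [div_le_one hn]; linarith⟩
  have hr : ((j + 1 : ℕ) / n : ℝ) ∈ Icc (0 : ℝ) 1 :=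
    ⟨by positivity, by rw [div_le_one hn]; push_cast; linarith⟩
  have hlen : ((j + 1 : ℕ) / n : ℝ) - j / n = 1 / n := by push_cast; ring
  have h1 : ∫ r in (j / n : ℝ)..((j + 1 : ℕ) / n : ℝ), (n * (r - gridPoint n r) - 1 / 2) • g r
      = ∫ r in (j / n : ℝ)..((j + 1 : ℕ) / n : ℝ), (n * r - j - 1 / 2) • g r := by
    -- The floor jumps at the right end of the cell, a null set.
    refine intervalIntegral.integral_congr_ae ?_
    filter_upwards [(measure_eq_zero_iff_ae_notMem).1
      (measure_singleton (μ := (volume : Measure ℝ)) ((j + 1 : ℕ) / n : ℝ))] with r hr0 hr1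
    rw [uIoc_of_le hle] at hr1
    have hlt : r < (j + 1 : ℕ) / n := lt_of_le_of_ne hr1.2 hr0
    have hfl : ⌊(n : ℝ) * r⌋₊ = j := by
      rw [Nat.floor_eq_iff (by have := hl.1.trans hr1.1.le; positivity)]
      have hgt := (div_lt_iff₀' hn).1 hr1.1
      rw [lt_div_iff₀' hn] at hlt
      push_cast at hlt
      exact ⟨hgt.le, hlt⟩
    rw [gridPoint, hfl, mul_sub, mul_div_cancel₀ _ hn.ne']
  have h2 : ∫ r in (j / n : ℝ)..((j + 1 : ℕ) / n : ℝ), ((n : ℝ) * r - j - 1 / 2) = 0 := by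
    rw [intervalIntegral.integral_sub, intervalIntegral.integral_sub,
      intervalIntegral.integral_const_mul, integral_id]
    · simp only [intervalIntegral.integral_const, smul_eq_mul]
      push_cast
      field_simp
      ring
    all_goals exact Continuous.intervalIntegrable (by fun_prop) _ _
  have hc : ContinuousOn (fun r : ℝ => (n : ℝ) * r - j - 1 / 2) (Icc 0 1) := by fun_prop
  have h3 : ∫ r in (j / n : ℝ)..((j + 1 : ℕ) / n : ℝ), (n * r - j - 1 / 2) • g r
      = ∫ r in (j / n : ℝ)..((j + 1 : ℕ) / n : ℝ), ((n : ℝ) * r - j - 1 / 2) •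
          (g r - g (j / n)) := by
    have i1 : IntervalIntegrable (fun r : ℝ => ((n : ℝ) * r - j - 1 / 2) • g r) volume
        (j / n : ℝ) ((j + 1 : ℕ) / n : ℝ) :=
      intervalIntegrable_of_continuousOn (hc.smul hg) hl hr
    have i2 : IntervalIntegrable (fun r : ℝ => ((n : ℝ) * r - j - 1 / 2) • g (j / n)) volume
        (j / n : ℝ) ((j + 1 : ℕ) / n : ℝ) :=
      intervalIntegrable_of_continuousOn (hc.smul continuousOn_const) hl hr
    simp only [smul_sub]
    rw [intervalIntegral.integral_sub i1 i2,
      intervalIntegral.integral_smul_const, h2, zero_smul, sub_zero]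
  rw [h1, h3]
  refine (intervalIntegral.norm_integral_le_of_norm_le_const (C := ε) fun r hr1 => ?_).trans
    (by rw [hlen, abs_of_pos (by positivity), mul_one_div])
  rw [uIoc_of_le hle] at hr1
  have hrI : r ∈ Icc (0 : ℝ) 1 := ⟨hl.1.trans hr1.1.le, hr1.2.trans hr.2⟩
  have hd : |r - j / n| ≤ 1 / n := by
    rw [abs_of_nonneg (by linarith [hr1.1])]; linarith [hr1.2]
  have hb := hε r hrI _ hl hd
  rw [norm_smul]
  refine (mul_le_of_le_one_left (norm_nonneg _) ?_).trans hb
  have hgt := (div_lt_iff₀' hn).1 hr1.1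
  have hle' := (le_div_iff₀' hn).1 hr1.2
  push_cast at hle'
  rw [Real.norm_eq_abs, abs_le]
  constructor <;> linarith

/-- The sawtooth `n * (s - gridPoint n s)` averages to `1 / 2` on every cell of the grid, so it
converges weakly to `1 / 2`. -/
lemma eventually_norm_integral_sawtooth_le [CompleteSpace E] {g : ℝ → E}
    (hg : ContinuousOn g (Icc 0 1)) {ε : ℝ} (hε : 0 < ε) :
    ∀ᶠ n : ℕ in atTop, ∀ t ∈ Icc (0 : ℝ) 1,
      ‖∫ r in (0 : ℝ)..t, (n * (r - gridPoint n r) - 1 / 2) • g r‖ ≤ ε := by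
  obtain ⟨M, hM⟩ := isCompact_Icc.exists_bound_of_continuousOn hg
  filter_upwards [eventually_forall_norm_sub_le hg (half_pos hε), eventually_ge_atTop 1,
    (tendsto_const_div_atTop_nhds_zero_nat M).eventually_lt_const (half_pos hε)]
    with n hosc hn1 hMn t ht
  have hn : (0 : ℝ) < n := by exact_mod_cast hn1
  have hmem : ∀ j : ℕ, j ≤ n → (j / n : ℝ) ∈ Icc (0 : ℝ) 1 := fun j hj =>
    ⟨by positivity, by rw [div_le_one hn]; exact_mod_cast hj⟩
  have h0 : (0 : ℝ) ∈ Icc (0 : ℝ) 1 := by simp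
  have hcells : ∀ j : ℕ, j ≤ n →
      ‖∫ r in (0 : ℝ)..(j / n : ℝ), (n * (r - gridPoint n r) - 1 / 2) • g r‖
        ≤ j * (ε / 2 / n) := by
    intro j
    induction j with
    | zero => simp
    | succ j ih =>
      intro hj
      rw [← intervalIntegral.integral_add_adjacent_intervals
        (intervalIntegrable_sawtooth_smul hg n _ h0 (hmem j (by omega)))
        (intervalIntegrable_sawtooth_smul hg n _ (hmem j (by omega)) (hmem _ hj))]
      refine (norm_add_le _ _).trans ((add_le_add (ih (by omega))
        (norm_integral_sawtooth_cell_le hg hj hosc)).trans (le_of_eq ?_))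
      push_cast
      ring
  set k := ⌊(n : ℝ) * t⌋₊ with hk
  have hkn : k ≤ n := Nat.floor_le_of_le (by nlinarith [ht.2])
  have hkt : (k / n : ℝ) = gridPoint n t := rfl
  rw [← intervalIntegral.integral_add_adjacent_intervals
    (intervalIntegrable_sawtooth_smul hg n _ h0 (hmem k hkn))
    (intervalIntegrable_sawtooth_smul hg n _ (hmem k hkn) ht)]
  refine (norm_add_le _ _).trans ?_
  -- The complete cells up to `gridPoint n t = k / n`, then the incomplete one.
  have hfirst : (k : ℝ) * (ε / 2 / n) ≤ ε / 2 := by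
    have : (k : ℝ) ≤ n := by exact_mod_cast hkn
    calc (k : ℝ) * (ε / 2 / n) ≤ n * (ε / 2 / n) := by gcongr
      _ = ε / 2 := by field_simp
  have hM0 : 0 ≤ M := (norm_nonneg _).trans (hM 0 h0)
  have hlast : ‖∫ r in (k / n : ℝ)..t, (n * (r - gridPoint n r) - 1 / 2) • g r‖ ≤ M / n := by
    refine (intervalIntegral.norm_integral_le_of_norm_le_const (C := M) fun r hr => ?_).trans ?_
    · rw [uIoc_of_le (hkt ▸ gridPoint_le hn1 ht.1)] at hr
      have hr0 : 0 ≤ r := (hmem k hkn).1.trans hr.1.le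
      have h1 := mul_sub_gridPoint_lt hn1 r
      have h2 : 0 ≤ n * (r - gridPoint n r) :=
        mul_nonneg hn.le (sub_nonneg.2 (gridPoint_le hn1 hr0))
      rw [norm_smul]
      refine (mul_le_of_le_one_left (norm_nonneg _) ?_).trans (hM r ⟨hr0, hr.2.trans ht.2⟩)
      rw [Real.norm_eq_abs, abs_le]
      constructor <;> linarith
    · rw [hkt, div_eq_mul_one_div]
      exact mul_le_mul_of_nonneg_left (abs_sub_gridPoint_le hn1 ht.1) hM0
  linarith [hcells k hkn]

/-! ### Approximate solutions of a linear Volterra equation -/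

/-- By Grönwall's inequality two approximate solutions of a linear Volterra equation are close,
so approximate solutions with vanishing defect converge, to an exact solution. -/
lemma exists_tendsto_of_approx_volterra [CompleteSpace E] {A : ℝ → E →L[ℝ] E} {g : ℝ → E}
    {e : ℕ → ℝ → E} {K : ℝ} (hA : ContinuousOn A (Icc 0 1)) (hAK : ∀ t ∈ Icc (0 : ℝ) 1, ‖A t‖ ≤ K)
    (hg : ContinuousOn g (Icc 0 1)) (he : ∀ᶠ n in atTop, ContinuousOn (e n) (Icc 0 1))
    (hdef : ∀ ε > 0, ∀ᶠ n in atTop, ∀ t ∈ Icc (0 : ℝ) 1,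
      ‖e n t - ∫ s in (0 : ℝ)..t, (A s (e n s) + g s)‖ ≤ ε) :
    ∃ c : ℝ → E, (∀ t ∈ Icc (0 : ℝ) 1, Tendsto (fun n => e n t) atTop (𝓝 (c t))) ∧
      ContinuousOn c (Icc 0 1) ∧
      ∀ t ∈ Icc (0 : ℝ) 1, c t = ∫ s in (0 : ℝ)..t, (A s (c s) + g s) := by
  have h0 : (0 : ℝ) ∈ Icc (0 : ℝ) 1 := by simp
  have hK : 0 ≤ K := (norm_nonneg _).trans (hAK 0 h0)
  have hcau : UniformCauchySeqOn e atTop (Icc 0 1) := by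
    rw [Metric.uniformCauchySeqOn_iff]
    intro ε hε
    set η := ε / (4 * Real.exp K) with hη
    have hηpos : 0 < η := by positivity
    obtain ⟨N, hN⟩ := eventually_atTop.1 (he.and (hdef η hηpos))
    refine ⟨N, fun m hm n hn => ?_⟩
    obtain ⟨hmc, hmd⟩ := hN m hm
    obtain ⟨hnc, hnd⟩ := hN n hn
    have hfin : ∀ t ∈ Icc (0 : ℝ) 1, ‖e m t - e n t‖ ≤ 2 * η * Real.exp K := by
      refine le_mul_exp_of_le_add_integral (hmc.sub hnc).norm (fun _ _ => norm_nonneg _)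
        (by positivity) hK fun t ht => ?_
      have hsub : (∫ s in (0 : ℝ)..t, (A s (e m s) + g s)) -
          ∫ s in (0 : ℝ)..t, (A s (e n s) + g s) = ∫ s in (0 : ℝ)..t, A s (e m s - e n s) := by
        have hi : ∀ f : ℝ → E, ContinuousOn f (Icc 0 1) →
            IntervalIntegrable (fun s => A s (f s) + g s) volume 0 t := fun f hf =>
          intervalIntegrable_of_continuousOn ((hA.clm_apply hf).add hg) h0 ht
        rw [← intervalIntegral.integral_sub (hi _ hmc) (hi _ hnc)]
        simp
      have hint : ‖∫ s in (0 : ℝ)..t, A s (e m s - e n s)‖ ≤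
          K * ∫ s in (0 : ℝ)..t, ‖e m s - e n s‖ := by
        rw [← intervalIntegral.integral_const_mul]
        refine intervalIntegral.norm_integral_le_of_norm_le ht.1
          (Eventually.of_forall fun s hs => ?_)
          ((intervalIntegrable_of_continuousOn (hmc.sub hnc).norm h0 ht).const_mul K)
        exact (A s).le_of_opNorm_le (hAK s ⟨hs.1.le, hs.2.trans ht.2⟩) _
      have hsplit : e m t - e n t = (e m t - ∫ s in (0 : ℝ)..t, (A s (e m s) + g s)) -
          (e n t - ∫ s in (0 : ℝ)..t, (A s (e n s) + g s)) +
          ∫ s in (0 : ℝ)..t, A s (e m s - e n s) := by rw [← hsub]; abel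
      rw [hsplit]
      refine (norm_add_le _ _).trans (add_le_add ((norm_sub_le _ _).trans ?_) hint)
      linarith [hmd t ht, hnd t ht]
    intro t ht
    rw [dist_eq_norm]
    refine (hfin t ht).trans_lt ?_
    rw [hη]
    field_simp
    linarith
  have hex : ∀ t, ∃ y, t ∈ Icc (0 : ℝ) 1 → Tendsto (fun n => e n t) atTop (𝓝 y) := by
    intro t
    by_cases ht : t ∈ Icc (0 : ℝ) 1
    · obtain ⟨y, hy⟩ := cauchySeq_tendsto_of_complete (hcau.cauchySeq ht)
      exact ⟨y, fun _ => hy⟩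
    · exact ⟨0, fun h => absurd h ht⟩
  choose c hc using hex
  have hunif : TendstoUniformlyOn e c atTop (Icc 0 1) :=
    hcau.tendstoUniformlyOn_of_tendsto hc
  have hcc : ContinuousOn c (Icc 0 1) := hunif.continuousOn he.frequently
  refine ⟨c, hc, hcc, fun t ht => ?_⟩
  have hlim : Tendsto (fun n => ∫ s in (0 : ℝ)..t, (A s (e n s) + g s)) atTop
      (𝓝 (∫ s in (0 : ℝ)..t, (A s (c s) + g s))) := by
    refine TendstoUniformlyOn.tendsto_intervalIntegral_of_continuousOn ?_ ?_
    · filter_upwards [he] with n hn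
      exact ((hA.clm_apply hn).add hg).mono (uIcc_subset_Icc h0 ht)
    · rw [Metric.tendstoUniformlyOn_iff] at hunif ⊢
      intro ε hε
      filter_upwards [hunif (ε / (K + 1)) (by positivity)] with n hn s hs
      have hs := uIcc_subset_Icc h0 ht hs
      have h1 := hn s hs
      rw [dist_eq_norm] at h1 ⊢
      rw [add_sub_add_right_eq_sub, ← map_sub]
      refine ((A s).le_of_opNorm_le (hAK s hs) _).trans_lt ?_
      rw [lt_div_iff₀ (by positivity)] at h1
      nlinarith [norm_nonneg (c s - e n s)]
  have hdiff : Tendsto (fun n => e n t - ∫ s in (0 : ℝ)..t, (A s (e n s) + g s)) atTop (𝓝 0) := by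
    rw [Metric.tendsto_nhds]
    intro ε hε
    filter_upwards [hdef (ε / 2) (half_pos hε)] with n hn
    rw [dist_zero_right]
    exact (hn t ht).trans_lt (half_lt_self hε)
  exact sub_eq_zero.1 (tendsto_nhds_unique ((hc t ht).sub hlim) hdiff)

/-! ### First order expansions -/

/-- A `C¹` path moves at uniformly almost constant velocity over time spans `1 / n`. -/
lemma eventually_norm_sub_sub_smul_le {X V : ℝ → E}
    (hX : ∀ t ∈ Icc (0 : ℝ) 1, HasDerivWithinAt X (V t) (Icc 0 1) t)
    (hV : ContinuousOn V (Icc 0 1)) {ε : ℝ} (hε : 0 < ε) :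
    ∀ᶠ n : ℕ in atTop, ∀ s ∈ Icc (0 : ℝ) 1, ∀ r ∈ Icc (0 : ℝ) 1, r ≤ s → |s - r| ≤ 1 / n →
      ‖X s - X r - (s - r) • V s‖ ≤ ε * |s - r| := by
  filter_upwards [eventually_forall_norm_sub_le hV hε] with n hn s hs r hr hrs hsr
  have hsub : Icc r s ⊆ Icc 0 1 := Icc_subset_Icc hr.1 hs.2
  have := (convex_Icc r s).norm_image_sub_le_of_norm_hasDerivWithin_le
    (f := fun u => X u - u • V s) (f' := fun u => V u - V s) (C := ε)
    (fun u hu => by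
      simpa only [one_smul, id] using ((hX u (hsub hu)).mono hsub).fun_sub
        ((hasDerivWithinAt_id u (Icc r s)).smul_const (V s)))
    (fun u hu => hn u (hsub hu) s hs ?_) (left_mem_Icc.2 hrs) (right_mem_Icc.2 hrs)
  · convert! this using 2
    rw [sub_smul]; abel
  · rw [abs_sub_comm, abs_of_nonneg (by linarith [hu.2])]
    rw [abs_of_nonneg (by linarith)] at hsr
    linarith [hu.1]

/-- The first order Taylor expansion of a `C¹` map is uniform along a compact set. -/
lemma exists_norm_sub_sub_fderiv_le {b : E → E} (hb : ContDiff ℝ 1 b) {S : Set E}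
    (hS : IsCompact S) {ε : ℝ} (hε : 0 < ε) :
    ∃ δ > 0, ∀ x ∈ S, ∀ y, ‖x - y‖ < δ → ‖b x - b y - fderiv ℝ b x (x - y)‖ ≤ ε * ‖x - y‖ := by
  have hu := hS.uniformContinuousAt_of_continuousAt (fderiv ℝ b)
    (fun a _ => (hb.continuous_fderiv one_ne_zero).continuousAt) (Metric.dist_mem_uniformity hε)
  obtain ⟨δ, hδ, h⟩ := Metric.mem_uniformity_dist.1 hu
  refine ⟨δ, hδ, fun x hx y hxy => ?_⟩
  refine (convex_ball x δ).norm_image_sub_le_of_norm_fderiv_le' (𝕜 := ℝ)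
    (fun z _ => (hb.differentiable one_ne_zero) z) (fun z hz => ?_)
    (by rwa [mem_ball_iff_norm']) (Metric.mem_ball_self hδ)
  have := h (a := x) (b := z) (by rw [dist_comm]; exact hz) hx
  rw [← dist_eq_norm, dist_comm]
  exact le_of_lt this

/-! ### The Euler scheme along one path -/

lemma error_sub_eq_integral {b : E → E} (hb : Continuous b) {X Y : ℝ → E}
    (hX : ContinuousOn X (Icc 0 1)) {n : ℕ}
    (hD : ∀ t ∈ Icc (0 : ℝ) 1, X t - Y t = ∫ s in (0 : ℝ)..t, (b (X s) - b (Y (gridPoint n s))))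
    {s t : ℝ} (hs : s ∈ Icc (0 : ℝ) 1) (ht : t ∈ Icc (0 : ℝ) 1) :
    (X t - Y t) - (X s - Y s) = ∫ r in s..t, (b (X r) - b (Y (gridPoint n r))) := by
  have h0 : (0 : ℝ) ∈ Icc (0 : ℝ) 1 := by simp
  rw [hD t ht, hD s hs, intervalIntegral.integral_interval_sub_left
    (intervalIntegrable_drift_sub hb hX Y n h0 ht) (intervalIntegrable_drift_sub hb hX Y n h0 hs)]

lemma norm_error_sub_le {b : E → E} (hb : Continuous b) {M : ℝ} (hM : ∀ x, ‖b x‖ ≤ M)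
    {X Y : ℝ → E} (hX : ContinuousOn X (Icc 0 1)) {n : ℕ}
    (hD : ∀ t ∈ Icc (0 : ℝ) 1, X t - Y t = ∫ s in (0 : ℝ)..t, (b (X s) - b (Y (gridPoint n s))))
    {s t : ℝ} (hs : s ∈ Icc (0 : ℝ) 1) (ht : t ∈ Icc (0 : ℝ) 1) :
    ‖(X t - Y t) - (X s - Y s)‖ ≤ 2 * M * |t - s| := by
  rw [error_sub_eq_integral hb hX hD hs ht]
  refine intervalIntegral.norm_integral_le_of_norm_le_const fun r _ => ?_
  refine (norm_sub_le _ _).trans ?_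
  linarith [hM (X r), hM (Y (gridPoint n r))]

lemma continuousOn_error {b : E → E} (hb : Continuous b) {M : ℝ} (hM : ∀ x, ‖b x‖ ≤ M)
    {X Y : ℝ → E} (hX : ContinuousOn X (Icc 0 1)) {n : ℕ}
    (hD : ∀ t ∈ Icc (0 : ℝ) 1,
      X t - Y t = ∫ s in (0 : ℝ)..t, (b (X s) - b (Y (gridPoint n s)))) :
    ContinuousOn (fun t => X t - Y t) (Icc 0 1) := by
  have hM0 : 0 ≤ M := (norm_nonneg _).trans (hM 0)
  refine (LipschitzOnWith.of_dist_le_mul (K := ⟨2 * M, by positivity⟩)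
    fun t ht s hs => ?_).continuousOn
  rw [dist_eq_norm, Real.dist_eq]
  exact norm_error_sub_le hb hM hX hD hs ht

/-- The Euler scheme has order one: by Grönwall's inequality the distance from `X s` to the value
of the scheme at the last grid point is at most a constant over `n`. -/
lemma norm_sub_comp_gridPoint_le {b : E → E} (hb : Continuous b) {M K L : ℝ} (hK : 0 ≤ K)
    (hM : ∀ x, ‖b x‖ ≤ M) (hbK : ∀ x y, ‖b x - b y‖ ≤ K * ‖x - y‖)
    {X Y : ℝ → E} (hX : ContinuousOn X (Icc 0 1)) {n : ℕ} (hn : 1 ≤ n)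
    (hL : ∀ t ∈ Icc (0 : ℝ) 1, ∀ s ∈ Icc (0 : ℝ) 1, ‖X t - X s‖ ≤ L * |t - s|) (hL0 : 0 ≤ L)
    (hD : ∀ t ∈ Icc (0 : ℝ) 1, X t - Y t = ∫ s in (0 : ℝ)..t, (b (X s) - b (Y (gridPoint n s))))
    {s : ℝ} (hs : s ∈ Icc (0 : ℝ) 1) :
    ‖X s - Y (gridPoint n s)‖ ≤ (L + 2 * M) * (K * Real.exp K + 1) / n := by
  have h0 : (0 : ℝ) ∈ Icc (0 : ℝ) 1 := by simp
  have hM0 : 0 ≤ M := (norm_nonneg _).trans (hM 0)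
  have hn' : (0 : ℝ) < n := by exact_mod_cast hn
  have hcont := continuousOn_error hb hM hX hD
  have hlocal : ∀ s ∈ Icc (0 : ℝ) 1,
      ‖X s - Y (gridPoint n s)‖ ≤ ‖X s - Y s‖ + (L + 2 * M) / n := fun s hs => by
    have hg := gridPoint_mem hn hs
    have hsg := abs_sub_gridPoint_le hn hs.1
    have h1 := (hL s hs _ hg).trans (mul_le_mul_of_nonneg_left hsg hL0)
    have h2 := (norm_error_sub_le hb hM hX hD hg hs).trans
      (mul_le_mul_of_nonneg_left hsg (by positivity))
    have hsplit : X s - Y (gridPoint n s) = (X s - Y s) + (X s - X (gridPoint n s)) -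
        ((X s - Y s) - (X (gridPoint n s) - Y (gridPoint n s))) := by abel
    rw [hsplit]
    refine (norm_sub_le _ _).trans ((add_le_add (norm_add_le _ _) le_rfl).trans ?_)
    have : (L + 2 * M) / n = L * (1 / n) + 2 * M * (1 / n) := by ring
    linarith
  have hgron : ∀ t ∈ Icc (0 : ℝ) 1,
      ‖X t - Y t‖ ≤ K * ((L + 2 * M) / n) * Real.exp K := by
    refine le_mul_exp_of_le_add_integral hcont.norm (fun _ _ => norm_nonneg _)
      (by positivity) hK fun t ht => ?_
    have hi := (intervalIntegrable_of_continuousOn hcont.norm h0 ht).const_mul K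
    rw [hD t ht]
    refine (intervalIntegral.norm_integral_le_of_norm_le
      (g := fun s => K * ((L + 2 * M) / n) + K * ‖X s - Y s‖) ht.1
      (Eventually.of_forall fun s hs => ?_) (intervalIntegrable_const.add hi)).trans ?_
    · refine (hbK _ _).trans ?_
      have := hlocal s ⟨hs.1.le, hs.2.trans ht.2⟩
      nlinarith
    · rw [intervalIntegral.integral_add intervalIntegrable_const hi,
        intervalIntegral.integral_const, intervalIntegral.integral_const_mul, smul_eq_mul]
      have : 0 ≤ K * ((L + 2 * M) / n) := by positivity
      exact add_le_add (mul_le_of_le_one_left this (by linarith [ht.2])) le_rfl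
  refine (hlocal s hs).trans ((add_le_add (hgron s hs) le_rfl).trans (le_of_eq ?_))
  ring

/-- The normalised error `n (X - Y n)` solves, up to a uniformly small defect, the linear
equation with coefficient `fderiv ℝ b (X t)` and forcing `(1 / 2) fderiv ℝ b (X t) (V t)`, where
`V` is the velocity of `X`. -/
lemma eventually_norm_error_defect_le [CompleteSpace E] {b : E → E} (hb : ContDiff ℝ 1 b)
    {M K : ℝ} (hM : ∀ x, ‖b x‖ ≤ M) (hK : ∀ x, ‖fderiv ℝ b x‖ ≤ K)
    {X V : ℝ → E} {Y : ℕ → ℝ → E}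
    (hX : ∀ t ∈ Icc (0 : ℝ) 1, HasDerivWithinAt X (V t) (Icc 0 1) t)
    (hV : ContinuousOn V (Icc 0 1))
    (hD : ∀ n : ℕ, 1 ≤ n → ∀ t ∈ Icc (0 : ℝ) 1,
      X t - Y n t = ∫ s in (0 : ℝ)..t, (b (X s) - b (Y n (gridPoint n s))))
    {ε : ℝ} (hε : 0 < ε) :
    ∀ᶠ n : ℕ in atTop, ∀ t ∈ Icc (0 : ℝ) 1,
      ‖(n : ℝ) • (X t - Y n t) - ∫ s in (0 : ℝ)..t, (fderiv ℝ b (X s) ((n : ℝ) • (X s - Y n s)) +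
        (1 / 2 : ℝ) • fderiv ℝ b (X s) (V s))‖ ≤ ε := by
  have h0 : (0 : ℝ) ∈ Icc (0 : ℝ) 1 := by simp
  have hXc : ContinuousOn X (Icc 0 1) := fun t ht => (hX t ht).continuousWithinAt
  have hA : ContinuousOn (fun t => fderiv ℝ b (X t)) (Icc 0 1) :=
    (hb.continuous_fderiv one_ne_zero).comp_continuousOn hXc
  have hAV : ContinuousOn (fun t => fderiv ℝ b (X t) (V t)) (Icc 0 1) := hA.clm_apply hV
  have hK0 : 0 ≤ K := (norm_nonneg _).trans (hK 0)
  have hM0 : 0 ≤ M := (norm_nonneg _).trans (hM 0)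
  have hbK : ∀ x y, ‖b x - b y‖ ≤ K * ‖x - y‖ := fun x y =>
    convex_univ.norm_image_sub_le_of_norm_fderiv_le (𝕜 := ℝ)
      (fun z _ => hb.differentiable one_ne_zero z) (fun z _ => hK z) (mem_univ y) (mem_univ x)
  obtain ⟨L, hL⟩ := isCompact_Icc.exists_bound_of_continuousOn hV
  have hL0 : 0 ≤ L := (norm_nonneg _).trans (hL 0 h0)
  have hXL : ∀ t ∈ Icc (0 : ℝ) 1, ∀ s ∈ Icc (0 : ℝ) 1, ‖X t - X s‖ ≤ L * |t - s| :=
    fun t ht s hs => (convex_Icc 0 1).norm_image_sub_le_of_norm_hasDerivWithin_le hX hL hs ht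
  set C := (L + 2 * M) * (K * Real.exp K + 1) with hC
  have hC0 : 0 ≤ C := by positivity
  -- The constant collects the bounds for the expansions of `b` and of `X`, and for the increment
  -- of the error over one cell.
  set η := ε / (C + K + K + 1) / 2 with hη
  have hηpos : 0 < η := by positivity
  obtain ⟨δ, hδ, hTaylor⟩ :=
    exists_norm_sub_sub_fderiv_le hb (isCompact_Icc.image_of_continuousOn hXc) hηpos
  filter_upwards [eventually_ge_atTop 1, eventually_norm_sub_sub_smul_le hX hV hηpos,
    eventually_norm_integral_sawtooth_le hAV (half_pos hε),
    (tendsto_const_div_atTop_nhds_zero_nat C).eventually_lt_const hδ,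
    (tendsto_const_div_atTop_nhds_zero_nat (K * C)).eventually_lt_const hηpos]
    with n hn hvel hsaw hnδ hnη t ht
  have hn' : (0 : ℝ) < n := by exact_mod_cast hn
  have hDn := hD n hn
  have hlag : ∀ s ∈ Icc (0 : ℝ) 1, ‖X s - Y n (gridPoint n s)‖ ≤ C / n := fun s hs =>
    norm_sub_comp_gridPoint_le hb.continuous hK0 hM hbK hXc hn hXL hL0 hDn hs
  have hErr : ∀ s ∈ Icc (0 : ℝ) 1, ‖(X s - Y n s) -
      (X (gridPoint n s) - Y n (gridPoint n s))‖ ≤ K * C / n * (1 / n) := fun s hs => by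
    have hg := gridPoint_mem hn hs
    rw [error_sub_eq_integral hb.continuous hXc hDn hg hs]
    refine (intervalIntegral.norm_integral_le_of_norm_le_const (C := K * C / n)
      fun r hr => ?_).trans (mul_le_mul_of_nonneg_left (abs_sub_gridPoint_le hn hs.1)
        (by positivity))
    refine (hbK _ _).trans ((mul_le_mul_of_nonneg_left (hlag r ?_) hK0).trans
      (le_of_eq (by ring)))
    rw [uIoc_of_le (gridPoint_le hn hs.1)] at hr
    exact ⟨hg.1.trans hr.1.le, hr.2.trans hs.2⟩
  have hDc := continuousOn_error hb.continuous hM hXc hDn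
  -- The integrand of the defect, with the forcing weighted by the sawtooth instead of its mean `1 / 2`.
  have hpt : ∀ s ∈ Icc (0 : ℝ) 1,
      ‖(n : ℝ) • (b (X s) - b (Y n (gridPoint n s))) - fderiv ℝ b (X s) ((n : ℝ) • (X s - Y n s)) -
        (n * (s - gridPoint n s)) • fderiv ℝ b (X s) (V s)‖ ≤ ε / 2 := fun s hs => by
    have hg := gridPoint_mem hn hs
    have hsg := abs_sub_gridPoint_le hn hs.1
    have e1 := (hTaylor (X s) (mem_image_of_mem X hs) (Y n (gridPoint n s))
      ((hlag s hs).trans_lt hnδ)).trans (mul_le_mul_of_nonneg_left (hlag s hs) hηpos.le)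
    have e2 := (fderiv ℝ b (X s)).le_of_opNorm_le_of_le (hK _)
      ((hvel s hs _ hg (gridPoint_le hn hs.1) hsg).trans
        (mul_le_mul_of_nonneg_left hsg hηpos.le))
    have e3 := (fderiv ℝ b (X s)).le_of_opNorm_le_of_le (hK _) (hErr s hs)
    -- Uses `X s - Y k = (X s - Y s) + (X s - X k) - ((X s - Y s) - (X k - Y k))` for the last grid
    -- point `k` before `s`.
    have hsplit : (n : ℝ) • (b (X s) - b (Y n (gridPoint n s))) -
        fderiv ℝ b (X s) ((n : ℝ) • (X s - Y n s)) -
        (n * (s - gridPoint n s)) • fderiv ℝ b (X s) (V s) = (n : ℝ) •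
        ((b (X s) - b (Y n (gridPoint n s)) - fderiv ℝ b (X s) (X s - Y n (gridPoint n s))) +
          fderiv ℝ b (X s) (X s - X (gridPoint n s) - (s - gridPoint n s) • V s) -
          fderiv ℝ b (X s) ((X s - Y n s) - (X (gridPoint n s) - Y n (gridPoint n s)))) := by
      simp only [map_sub, map_smul, smul_sub, smul_add, smul_smul]
      abel
    rw [hsplit, norm_smul, Real.norm_of_nonneg hn'.le]
    calc (n : ℝ) * _ ≤ n * (η * (C / n) + K * (η * (1 / n)) + K * (K * C / n * (1 / n))) := by
          gcongr
          exact (norm_sub_le _ _).trans (add_le_add ((norm_add_le _ _).trans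
            (add_le_add e1 e2)) e3)
      _ = η * (C + K) + K * (K * C / n) := by field_simp
      _ ≤ η * (C + K) + K * η := by gcongr
      _ ≤ η * (C + K + K + 1) := by nlinarith
      _ = ε / 2 := by rw [hη]; field_simp
  have hi1 : IntervalIntegrable (fun s => (n : ℝ) • (b (X s) - b (Y n (gridPoint n s))))
      volume 0 t := (intervalIntegrable_drift_sub hb.continuous hXc (Y n) n h0 ht).smul (n : ℝ)
  have hi2 : IntervalIntegrable (fun s => fderiv ℝ b (X s) ((n : ℝ) • (X s - Y n s)))
      volume 0 t := intervalIntegrable_of_continuousOn (hA.clm_apply (hDc.const_smul (n : ℝ))) h0 ht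
  have hi3 : IntervalIntegrable (fun s => (1 / 2 : ℝ) • fderiv ℝ b (X s) (V s))
      volume 0 t := intervalIntegrable_of_continuousOn (hAV.const_smul (1 / 2 : ℝ)) h0 ht
  have hi4 := intervalIntegrable_sawtooth_smul hAV n (1 / 2) h0 ht
  have hsplit : (n : ℝ) • (X t - Y n t) -
      ∫ s in (0 : ℝ)..t, (fderiv ℝ b (X s) ((n : ℝ) • (X s - Y n s)) +
        (1 / 2 : ℝ) • fderiv ℝ b (X s) (V s)) =
      (∫ s in (0 : ℝ)..t, ((n : ℝ) • (b (X s) - b (Y n (gridPoint n s))) -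
        fderiv ℝ b (X s) ((n : ℝ) • (X s - Y n s)) -
        (n * (s - gridPoint n s)) • fderiv ℝ b (X s) (V s))) +
      ∫ s in (0 : ℝ)..t, (n * (s - gridPoint n s) - 1 / 2) • fderiv ℝ b (X s) (V s) := by
    have hcongr : ∀ s, (n : ℝ) • (b (X s) - b (Y n (gridPoint n s))) -
        fderiv ℝ b (X s) ((n : ℝ) • (X s - Y n s)) -
        (n * (s - gridPoint n s)) • fderiv ℝ b (X s) (V s) =
        (n : ℝ) • (b (X s) - b (Y n (gridPoint n s))) -
        (fderiv ℝ b (X s) ((n : ℝ) • (X s - Y n s)) + (1 / 2 : ℝ) • fderiv ℝ b (X s) (V s)) -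
        (n * (s - gridPoint n s) - 1 / 2) • fderiv ℝ b (X s) (V s) := fun s => by
      rw [sub_smul]; abel
    simp only [hcongr]
    rw [intervalIntegral.integral_sub (hi1.sub (hi2.add hi3)) hi4,
      intervalIntegral.integral_sub hi1 (hi2.add hi3), intervalIntegral.integral_smul,
      ← hDn t ht, sub_add_cancel]
  rw [hsplit]
  refine (norm_add_le _ _).trans ?_
  have hfirst := intervalIntegral.norm_integral_le_of_norm_le_const (a := 0) (b := t) (C := ε / 2)
    fun s hs => hpt s ?_
  · rw [sub_zero, abs_of_nonneg ht.1] at hfirst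
    have := hsaw t ht
    nlinarith [ht.2]
  · rw [uIoc_of_le ht.1] at hs
    exact ⟨hs.1.le, hs.2.trans ht.2⟩

/-- The asymptotic error of the Euler scheme for an equation driven by a `C¹` path `B`. -/
theorem exists_tendsto_error [CompleteSpace E] {b : E → E} (hb : ContDiff ℝ 1 b)
    {M K : ℝ} (hM : ∀ x, ‖b x‖ ≤ M) (hK : ∀ x, ‖fderiv ℝ b x‖ ≤ K)
    {x₀ : E} {B B' X : ℝ → E} {Y : ℕ → ℝ → E}
    (hB : ∀ t ∈ Icc (0 : ℝ) 1, HasDerivWithinAt B (B' t) (Icc 0 1) t)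
    (hB' : ContinuousOn B' (Icc 0 1)) (hXc : ContinuousOn X (Icc 0 1))
    (hX : ∀ t ∈ Icc (0 : ℝ) 1, X t = x₀ + (∫ s in (0 : ℝ)..t, b (X s)) + B t)
    (hY : ∀ n : ℕ, 1 ≤ n → ∀ t ∈ Icc (0 : ℝ) 1,
      Y n t = x₀ + (∫ s in (0 : ℝ)..t, b (Y n (gridPoint n s))) + B t) :
    ∃ c : ℝ → E,
      (∀ t ∈ Icc (0 : ℝ) 1, Tendsto (fun n : ℕ => (n : ℝ) • (X t - Y n t)) atTop (𝓝 (c t))) ∧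
      c 0 = 0 ∧ ∀ t ∈ Icc (0 : ℝ) 1, HasDerivWithinAt c (fderiv ℝ b (X t) (c t) +
        (1 / 2 : ℝ) • fderiv ℝ b (X t) (b (X t) + B' t)) (Icc 0 1) t := by
  have h0 : (0 : ℝ) ∈ Icc (0 : ℝ) 1 := by simp
  have hbX : ContinuousOn (fun t => b (X t)) (Icc 0 1) := hb.continuous.comp_continuousOn hXc
  have hV : ContinuousOn (fun t => b (X t) + B' t) (Icc 0 1) := hbX.add hB'
  have hXd : ∀ t ∈ Icc (0 : ℝ) 1, HasDerivWithinAt X (b (X t) + B' t) (Icc 0 1) t :=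
    fun t ht => (((hasDerivWithinAt_integral hbX ht).const_add x₀).fun_add (hB t ht)).congr hX
      (hX t ht)
  have hD : ∀ n : ℕ, 1 ≤ n → ∀ t ∈ Icc (0 : ℝ) 1,
      X t - Y n t = ∫ s in (0 : ℝ)..t, (b (X s) - b (Y n (gridPoint n s))) := fun n hn t ht => by
    rw [hX t ht, hY n hn t ht, intervalIntegral.integral_sub
      (intervalIntegrable_of_continuousOn hbX h0 ht)
      (intervalIntegrable_comp_gridPoint (fun r => b (Y n r)) n 0 t)]
    abel
  have hA : ContinuousOn (fun t => fderiv ℝ b (X t)) (Icc 0 1) :=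
    (hb.continuous_fderiv one_ne_zero).comp_continuousOn hXc
  have hg : ContinuousOn (fun t => (1 / 2 : ℝ) • fderiv ℝ b (X t) (b (X t) + B' t)) (Icc 0 1) :=
    (hA.clm_apply hV).const_smul _
  obtain ⟨c, hc, hcc, hceq⟩ := exists_tendsto_of_approx_volterra
    (e := fun n t => (n : ℝ) • (X t - Y n t)) hA (fun t _ => hK (X t)) hg
    ((eventually_ge_atTop 1).mono fun n hn =>
      (continuousOn_error hb.continuous hM hXc (hD n hn)).const_smul (n : ℝ))
    (fun ε hε => eventually_norm_error_defect_le hb hM hK hXd hV hD hε)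
  exact ⟨c, hc, by simpa using hceq 0 h0, fun t ht =>
    (hasDerivWithinAt_integral ((hA.clm_apply hcc).add hg) ht).congr hceq (hceq t ht)⟩

end Pathwise

/-! ### Paths of fractional Brownian motion and the drift for the lower bound -/

lemma continuousOn_iterIntegral {E : Type*} [NormedAddCommGroup E] [NormedSpace ℝ E]
    [CompleteSpace E] {f : ℝ → E} (hf : ContinuousOn f (Icc 0 1)) :
    ∀ k : ℕ, ContinuousOn (iterIntegral f k) (Icc 0 1)
  | 0 => hf
  | k + 1 => fun _ ht =>
    (hasDerivWithinAt_integral (continuousOn_iterIntegral hf k) ht).continuousWithinAt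

/-- Almost every path of `B` is `C¹`, and the initial velocity is measurable up to a null
set. -/
lemma IsFBM.exists_derivative {d : ℕ} {H : ℝ} (hH : 1 < H) {Ω : Type*} [MeasurableSpace Ω]
    {P : Measure Ω} {W B : ℝ → Ω → EuclideanSpace ℝ (Fin d)} (hB : IsFBM H W P B) :
    ∃ B' : ℝ → Ω → EuclideanSpace ℝ (Fin d), AEMeasurable (B' 0) P ∧
      ∀ᵐ ω ∂P, ContinuousOn (fun t => B' t ω) (Icc 0 1) ∧
        ∀ t ∈ Icc (0 : ℝ) 1, HasDerivWithinAt (fun s => B s ω) (B' t ω) (Icc 0 1) t := by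
  obtain ⟨β, hβ, hBβ⟩ := hB
  obtain ⟨k, hk⟩ : ∃ k, ⌊H⌋₊ = k + 1 :=
    Nat.exists_eq_succ_of_ne_zero (Nat.floor_pos.2 hH.le).ne'
  refine ⟨fun t ω => iterIntegral (fun s => β s ω) k t, ?_, ?_⟩
  · cases k with
    -- For `⌊H⌋ = 1` the initial velocity is `β 0`; otherwise it is an integral over `0..0`.
    | zero => exact (hβ.integral 0 le_rfl).1.1.aemeasurable
    | succ k => simp [iterIntegral]
  · filter_upwards [hβ.cont, hBβ] with ω hc hω
    have hcont := continuousOn_iterIntegral (hc.mono Icc_subset_Ici_self : ContinuousOn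
      (fun s => β s ω) (Icc 0 1)) k
    refine ⟨hcont, fun t ht => (hasDerivWithinAt_integral hcont ht).congr (fun s hs => ?_) ?_⟩
    · rw [hω s hs.1, hk]; rfl
    · rw [hω t ht.1, hk]; rfl

lemma IsFBM.zero_eq {d : ℕ} {H : ℝ} (hH : 1 < H) {Ω : Type*} [MeasurableSpace Ω]
    {P : Measure Ω} {W B : ℝ → Ω → EuclideanSpace ℝ (Fin d)} (hB : IsFBM H W P B) :
    ∀ᵐ ω ∂P, B 0 ω = 0 := by
  obtain ⟨β, -, hBβ⟩ := hB
  obtain ⟨k, hk⟩ : ∃ k, ⌊H⌋₊ = k + 1 :=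
    Nat.exists_eq_succ_of_ne_zero (Nat.floor_pos.2 hH.le).ne'
  filter_upwards [hBβ] with ω hω
  rw [hω 0 le_rfl, hk]
  simp [iterIntegral]

/-- A random vector in a nontrivial space takes only countably many values with positive
probability. -/
lemma exists_ae_ne {d : ℕ} (hd : 0 < d) {Ω : Type*} [MeasurableSpace Ω] {P : Measure Ω}
    [IsProbabilityMeasure P] {Z : Ω → EuclideanSpace ℝ (Fin d)} (hZ : AEMeasurable Z P) :
    ∃ v, ∀ᵐ ω ∂P, Z ω ≠ v := by
  have : Nonempty (Fin d) := ⟨⟨0, hd⟩⟩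
  have hcount := Measure.countable_meas_level_set_pos₀ (μ := P) hZ.nullMeasurable
  obtain ⟨v, hv⟩ := (hcount.dense_compl ℝ).nonempty
  refine ⟨v, ?_⟩
  rw [ae_iff]
  simpa using hv

/-- A field of class `𝒞¹` with prescribed value at `x₀` and with gradient the identity there:
`x - x₀`, cut off away from `x₀`, plus a constant. -/
lemma exists_isC1_fderiv_eq_id {d : ℕ} (x₀ v : EuclideanSpace ℝ (Fin d)) :
    ∃ b, IsC1 b ∧ b x₀ = v ∧ fderiv ℝ b x₀ = ContinuousLinearMap.id ℝ _ := by
  let φ : ContDiffBump x₀ := ⟨1, 2, one_pos, one_lt_two⟩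
  set f : EuclideanSpace ℝ (Fin d) → EuclideanSpace ℝ (Fin d) := fun x => φ x • (x - x₀) with hf
  have hfc : ContDiff ℝ 1 f := φ.contDiff.smul (contDiff_id.sub contDiff_const)
  have hfs : HasCompactSupport f := φ.hasCompactSupport.smul_right
  have hder : ∀ x, fderiv ℝ (fun x => v + f x) x = fderiv ℝ f x := fun x => fderiv_const_add v
  refine ⟨fun x => v + f x, ⟨contDiff_const.add hfc, ?_, ?_⟩, by simp [hf], ?_⟩
  · obtain ⟨C, hC⟩ := hfs.exists_bound_of_continuous hfc.continuous
    exact ⟨‖v‖ + C, fun x => (norm_add_le _ _).trans (add_le_add le_rfl (hC x))⟩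
  · obtain ⟨C, hC⟩ := (hfs.fderiv ℝ).exists_bound_of_continuous (hfc.continuous_fderiv one_ne_zero)
    exact ⟨C, fun x => by rw [hder]; exact hC x⟩
  · rw [hder]
    have hloc : f =ᶠ[𝓝 x₀] fun x => x - x₀ := by
      filter_upwards [φ.eventuallyEq_one] with x hx
      simp [hf, hx]
    rw [hloc.fderiv_eq]
    rw [fderiv_sub_const, fderiv_fun_id]

end EulerFBM

theorem theorem5p1 {d : ℕ} {H : ℝ} (hH : 1 < H) (hHint : ∀ k : ℤ, H ≠ k)
    {Ω : Type*} [MeasurableSpace Ω] {P : Measure Ω} [IsProbabilityMeasure P]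
    {W B : ℝ → Ω → EuclideanSpace ℝ (Fin d)}
    (hW : EulerFBM.IsTwoSidedBrownian W P) (hB : EulerFBM.IsFBM H W P B)
    (x₀ : EuclideanSpace ℝ (Fin d)) :
    -- existence of the limit and the linear equation that it solves
    (∀ b : EuclideanSpace ℝ (Fin d) → EuclideanSpace ℝ (Fin d), EulerFBM.IsC1 b →
      ∀ (X : ℝ → Ω → EuclideanSpace ℝ (Fin d)) (Y : ℕ → ℝ → Ω → EuclideanSpace ℝ (Fin d)),
        EulerFBM.IsSolution b B P x₀ X →
        (∀ n : ℕ, 1 ≤ n → EulerFBM.IsEuler n b B P x₀ (Y n)) →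
        ∀ᵐ ω ∂P, DifferentiableOn ℝ (fun t => B t ω) (Icc 0 1) ∧
          ∃ c : ℝ → EuclideanSpace ℝ (Fin d),
            (∀ t ∈ Icc (0 : ℝ) 1,
              Tendsto (fun n : ℕ => (n : ℝ) • (X t ω - Y n t ω)) atTop (𝓝 (c t))) ∧
            c 0 = 0 ∧
            ∀ t ∈ Icc (0 : ℝ) 1,
              HasDerivWithinAt c
                (fderiv ℝ b (X t ω) (c t) +
                  (1 / 2 : ℝ) • fderiv ℝ b (X t ω)
                    (b (X t ω) + derivWithin (fun s => B s ω) (Icc 0 1) t))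
                (Icc 0 1) t) ∧
    -- the rate cannot be improved in general: for some drift the limit does not vanish
    (0 < d →
      ∃ b : EuclideanSpace ℝ (Fin d) → EuclideanSpace ℝ (Fin d), EulerFBM.IsC1 b ∧
        ∀ (X : ℝ → Ω → EuclideanSpace ℝ (Fin d)) (Y : ℕ → ℝ → Ω → EuclideanSpace ℝ (Fin d)),
          EulerFBM.IsSolution b B P x₀ X →
          (∀ n : ℕ, 1 ≤ n → EulerFBM.IsEuler n b B P x₀ (Y n)) →
          ∀ᵐ ω ∂P, ∃ t ∈ Icc (0 : ℝ) 1, ∃ v : EuclideanSpace ℝ (Fin d), v ≠ 0 ∧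
            Tendsto (fun n : ℕ => (n : ℝ) • (X t ω - Y n t ω)) atTop (𝓝 v)) := by
  open EulerFBM in
  have hmain : ∀ b : EuclideanSpace ℝ (Fin d) → EuclideanSpace ℝ (Fin d), IsC1 b →
      ∀ (X : ℝ → Ω → EuclideanSpace ℝ (Fin d)) (Y : ℕ → ℝ → Ω → EuclideanSpace ℝ (Fin d)),
        IsSolution b B P x₀ X → (∀ n : ℕ, 1 ≤ n → IsEuler n b B P x₀ (Y n)) →
        ∀ᵐ ω ∂P, DifferentiableOn ℝ (fun t => B t ω) (Icc 0 1) ∧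
          ∃ c : ℝ → EuclideanSpace ℝ (Fin d),
            (∀ t ∈ Icc (0 : ℝ) 1,
              Tendsto (fun n : ℕ => (n : ℝ) • (X t ω - Y n t ω)) atTop (𝓝 (c t))) ∧
            c 0 = 0 ∧
            ∀ t ∈ Icc (0 : ℝ) 1,
              HasDerivWithinAt c
                (fderiv ℝ b (X t ω) (c t) +
                  (1 / 2 : ℝ) • fderiv ℝ b (X t ω)
                    (b (X t ω) + derivWithin (fun s => B s ω) (Icc 0 1) t))
                (Icc 0 1) t := by
    obtain ⟨B', -, hB'⟩ := hB.exists_derivative hH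
    intro b hb X Y hX hY
    obtain ⟨M, hM⟩ := hb.bounded
    obtain ⟨K, hK⟩ := hb.bounded_fderiv
    have hY' : ∀ᵐ ω ∂P, ∀ n : ℕ, 1 ≤ n → ∀ t ∈ Icc (0 : ℝ) 1,
        Y n t ω = x₀ + (∫ s in (0 : ℝ)..t, b (Y n (gridPoint n s) ω)) + B t ω :=
      ae_all_iff.2 fun n => by
        by_cases hn : 1 ≤ n
        · filter_upwards [hY n hn] with ω hω using fun _ => hω
        · exact Eventually.of_forall fun ω h => absurd h hn
    filter_upwards [hB', hX, hY'] with ω hBω hXω hYω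
    refine ⟨fun t ht => (hBω.2 t ht).differentiableWithinAt, ?_⟩
    obtain ⟨c, hc, hc0, hcd⟩ := exists_tendsto_error hb.contDiff hM hK hBω.2 hBω.1
      hXω.1 hXω.2 (Y := fun n t => Y n t ω) hYω
    refine ⟨c, hc, hc0, fun t ht => ?_⟩
    rw [(hBω.2 t ht).derivWithin (uniqueDiffOn_Icc one_pos t ht)]
    exact hcd t ht
  refine ⟨hmain, fun hd => ?_⟩
  obtain ⟨B', hB'm, hB'⟩ := hB.exists_derivative hH
  obtain ⟨v, hv⟩ := EulerFBM.exists_ae_ne hd hB'm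
  -- With `b x₀ = -v` and `fderiv ℝ b x₀ = id`, the derivative of the limit `c` at time `0` is
  -- `(1 / 2) (B' 0 - v)`, which almost surely does not vanish.
  obtain ⟨b, hb, hbx, hbd⟩ := EulerFBM.exists_isC1_fderiv_eq_id x₀ (-v)
  refine ⟨b, hb, fun X Y hX hY => ?_⟩
  filter_upwards [hmain b hb X Y hX hY, hB', hv, hX, hB.zero_eq hH] with ω hω hBω hvω hXω hB0
  obtain ⟨-, c, hc, hc0, hcd⟩ := hω
  have h0 : (0 : ℝ) ∈ Icc (0 : ℝ) 1 := by simp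
  have hX0 : X 0 ω = x₀ := by simpa [hB0] using hXω.2 0 h0
  by_contra! hcon
  have hczero : ∀ t ∈ Icc (0 : ℝ) 1, c t = 0 := fun t ht => by
    by_contra hne
    exact hcon t ht (c t) hne (hc t ht)
  have hd0 := hcd 0 h0
  rw [hX0, hc0, map_zero, zero_add, hbx, hbd, ContinuousLinearMap.id_apply,
    (hBω.2 0 h0).derivWithin (uniqueDiffOn_Icc one_pos 0 h0)] at hd0
  have huniq := (uniqueDiffOn_Icc one_pos 0 h0).eq_deriv _ hd0
    ((hasDerivWithinAt_const (0 : ℝ) (Icc 0 1) (0 : EuclideanSpace ℝ (Fin d))).congr hczero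
      (hczero 0 h0))
  rw [smul_eq_zero_iff_right (by norm_num), neg_add_eq_zero] at huniq
  exact hvω huniq.symm
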